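/- All graphs are finite and simple. A \emph{trigraph} is a graph whose edges are coloured black or red; a graph is regarded as a trigraph all of whose edges are black. For a partition $\mathcal P$ of $V(G)$ into nonempty parts, $G/\mathcal P$ is the trigraph with vertex set $\mathcal P$ in which two distinct parts $U,W$ are joined by a black edge if every pair $uw$ with $u\in U$, $w\in W$ is a black edge of $G$, are non-adjacent if no such pair is an edge, and are joined by a red edge otherwise. A \emph{partition sequence} of an $n$-vertex trigraph $G$ is a sequence $\mathcal P_n,\dots,\mathcal P_1$ of partitions of $V(G)$ in which $\mathcal P_n$ is the partition into singletons and each $\mathcal P_i$ ($1\le i<n$) arises from $\mathcal P_{i+1}$ by replacing two distinct parts by their union. Its \emph{width} is the maximum, over all $i$, of the maximum number of red edges incident to a vertex of $G/\mathcal P_i$, and the \emph{twin-width} of $G$ is the minimum width of a partition sequence of $G$. **Theorem.** There is an absolute constant $C>0$ such that the following holds for all integers $d,k,\ell\ge 0$. Let $G$ be a graph with maximum degree exactly $d$ and twin-width at least $k$, where $k>\max(4d,d^2)$. Suppose that every graph $H$ with maximum degree exactly $d$ and fewer than $|V(G)|-\ell$ vertices has twin-width less than $k$. Then $$|\mathrm{Aut}(G)|\le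 (C\ell)^{\ell},$$ where $\mathrm{Aut}(G)$ is the automorphism group of $G$ and $0^0=1$ (so that $\mathrm{Aut}(G)$ is trivial if $\ell=0$). -/

import Mathlib

universe u

/-- A trigraph on `V`: a simple graph some of whose edges are coloured red, the other
edges being black. -/
structure Trigraph (V : Type u) where
  /-- The underlying simple graph (edges of both colours). -/
  graph : SimpleGraph V
  /-- The red edges. -/
  red : SimpleGraph V
  red_le : red ≤ graph

namespace Trigraph

/-- `v` and `w` are joined by a black edge. -/
def BlackAdj {V : Type u} (G : Trigraph V) (v w : V) : Prop :=
  G.graph.Adj v w ∧ ¬ G.red.Adj v w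

/-- The number of red edges incident to `v`. -/
noncomputable def redDegree {V : Type u} (G : Trigraph V) (v : V) : ℕ :=
  (G.red.neighborSet v).ncard

/-- Every pair in `U × W` is a black edge. -/
def FullyConnected {V : Type u} (G : Trigraph V) (U W : Set V) : Prop :=
  ∀ u ∈ U, ∀ w ∈ W, G.BlackAdj u w

/-- No pair in `U × W` is an edge, of either colour. -/
def Disconnected {V : Type u} (G : Trigraph V) (U W : Set V) : Prop :=
  ∀ u ∈ U, ∀ w ∈ W, ¬ G.graph.Adj u w

theorem FullyConnected.symm {V : Type u} {G : Trigraph V} {U W : Set V}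
    (h : G.FullyConnected U W) : G.FullyConnected W U :=
  fun w hw u hu => ⟨(h u hu w hw).1.symm, fun hr => (h u hu w hw).2 hr.symm⟩

theorem Disconnected.symm {V : Type u} {G : Trigraph V} {U W : Set V}
    (h : G.Disconnected U W) : G.Disconnected W U :=
  fun w hw u hu ha => h u hu w hw ha.symm

/-- The part (a set of vertices) that an element of `Quotient P` stands for. Partitions of `V`
are represented by equivalence relations on `V`; the parts are the equivalence classes. -/
def part {V : Type u} {P : Setoid V} (U : Quotient P) : Set V :=
  {v | Quotient.mk P v = U}

/-- The quotient trigraph `G / P`: its vertices are the parts of `P`; two distinct parts are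
non-adjacent if they are disconnected, joined by a black edge if they are fully connected,
and joined by a red edge otherwise. -/
def quotient {V : Type u} (G : Trigraph V) (P : Setoid V) : Trigraph (Quotient P) where
  graph :=
    { Adj := fun U W => U ≠ W ∧ ¬ G.Disconnected (part U) (part W)
      symm := ⟨fun _ _ h => ⟨h.1.symm, fun h' => h.2 h'.symm⟩⟩
      loopless := ⟨fun _ h => h.1 rfl⟩ }
  red :=
    { Adj := fun U W => U ≠ W ∧ ¬ G.Disconnected (part U) (part W) ∧
        ¬ G.FullyConnected (part U) (part W)
      symm := ⟨fun _ _ h => ⟨h.1.symm, fun h' => h.2.1 h'.symm, fun h' => h.2.2 h'.symm⟩⟩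
      loopless := ⟨fun _ h => h.1 rfl⟩ }
  red_le := fun _ _ h => ⟨h.1, h.2.1⟩

/-- `Q` is obtained from the partition `P` by replacing two distinct parts (those of `x` and
of `y`) by their union. -/
def IsMerge {V : Type u} (P Q : Setoid V) : Prop :=
  ∃ x y : V, ¬ P x y ∧
    ∀ a b : V, Q a b ↔ P a b ∨ ((P a x ∨ P a y) ∧ (P b x ∨ P b y))

/-- `P n, P (n - 1), …, P 1` is a partition sequence of an `n`-element set `V`: it starts with
the discrete partition and each step is a merge. The values of `P` at indices outside
`{1, …, n}` play no role. -/
def IsPartitionSequence {V : Type u} [Fintype V] (P : ℕ → Setoid V) : Prop :=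
  P (Fintype.card V) = ⊥ ∧
    ∀ i : ℕ, 1 ≤ i → i < Fintype.card V → IsMerge (P (i + 1)) (P i)

/-- The contraction sequence given by `P n, …, P 1` has width at most `k`. -/
def WidthAtMost {V : Type u} [Fintype V] (G : Trigraph V) (P : ℕ → Setoid V) (k : ℕ) : Prop :=
  ∀ i : ℕ, 1 ≤ i → i ≤ Fintype.card V → ∀ U : Quotient (P i), (G.quotient (P i)).redDegree U ≤ k

/-- The twin-width of `G`: the least `k` such that `G` has a contraction sequence of width at
most `k`. -/
noncomputable def twinWidth {V : Type u} [Fintype V] (G : Trigraph V) : ℕ :=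
  sInf {k : ℕ | ∃ P : ℕ → Setoid V, IsPartitionSequence P ∧ G.WidthAtMost P k}

end Trigraph

/-- A graph as a trigraph all of whose edges are black. -/
def SimpleGraph.toTrigraph {V : Type u} (G : SimpleGraph V) : Trigraph V where
  graph := G
  red := ⊥
  red_le := bot_le

/-- The twin-width of a finite simple graph. -/
noncomputable def SimpleGraph.twinWidth {V : Type u} [Fintype V] (G : SimpleGraph V) : ℕ :=
  G.toTrigraph.twinWidth

/-! An automorphism with few cycles yields a cheap contraction of `G`, so the hypothesis on smaller
graphs forces every automorphism to have at least `n - ℓ` cycles, where `n` is the number of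
vertices; a group of such permutations is small.

Since `k > d ^ 2`, a partition whose red degrees are below `k` has all its total degrees below `k`.
Total degree, unlike red degree, is monotone in the graph, so the argument runs with it throughout.

Given an automorphism, cut its cycles into blocks of `1, 2, 4, …` consecutive points. Partitions
between two successive stages have degree at most `4 * d < k`
(`SimpleGraph.quotientDegreeLT_of_blockSetoid`), so the orbit partition is reachable. The orbit
graph has maximum degree at most `d`. If it had fewer than `n - ℓ` vertices, either it would have at
most `d` vertices, or it would lie in a graph of maximum degree exactly `d` on the same vertices, to
which the hypothesis applies. Either way the contraction could be completed, giving twin-width below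
`k`: a contradiction (`SimpleGraph.card_le_card_sameCycle_add`).

Hence each automorphism has at most `ℓ` points off a transversal of its cycles, and moves at most `2
* ℓ` points. Averaging over the group, at most `4 * ℓ` points are moved in all. A permutation is
determined by a transversal and its values off it (`Equiv.Perm.eq_of_cycleRep`), which leaves at
most `2 ^ (4 * ℓ) * (4 * ℓ) ^ ℓ` automorphisms. -/

/-! ### Merges of parts and chains of merges -/

/-- The partition obtained from `P` by uniting the parts of `x` and `y`. -/
def Setoid.mergeParts {V : Type u} (P : Setoid V) (x y : V) : Setoid V where
  r a b := P a b ∨ ((P a x ∨ P a y) ∧ (P b x ∨ P b y))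
  iseqv :=
    { refl := fun a => Or.inl (P.refl a)
      symm := by
        rintro a b (h | ⟨h, h'⟩)
        · exact Or.inl (P.symm h)
        · exact Or.inr ⟨h', h⟩
      trans := by
        rintro a b c (h | ⟨h, h'⟩) (g | ⟨g, g'⟩)
        · exact Or.inl (P.trans h g)
        · exact Or.inr ⟨g.imp (P.trans h) (P.trans h), g'⟩
        · exact Or.inr ⟨h, h'.imp (P.trans (P.symm g)) (P.trans (P.symm g))⟩
        · exact Or.inr ⟨h, g'⟩ }

theorem Trigraph.isMerge_mergeParts {V : Type u} {P : Setoid V} {x y : V} (h : ¬ P x y) :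
    Trigraph.IsMerge P (P.mergeParts x y) :=
  ⟨x, y, h, fun _ _ => Iff.rfl⟩

theorem Setoid.mergeParts_le {V : Type u} {P Q : Setoid V} {x y : V} (hPQ : P ≤ Q)
    (h : Q x y) : P.mergeParts x y ≤ Q := by
  have key : ∀ a, (P a x ∨ P a y) → Q a x := fun a ha =>
    ha.elim (fun h1 => hPQ h1) (fun h1 => Q.trans (hPQ h1) (Q.symm h))
  rintro a b (hab | ⟨ha, hb⟩)
  · exact hPQ hab
  · exact Q.trans (key a ha) (Q.symm (key b hb))

theorem Trigraph.IsMerge.le {V : Type u} {P Q : Setoid V} (h : Trigraph.IsMerge P Q) :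
    P ≤ Q := by
  obtain ⟨x, y, -, hQ⟩ := h
  intro a b hab
  exact (hQ a b).2 (Or.inl hab)

theorem Trigraph.IsMerge.card_quotient {V : Type u} [Finite V] {P Q : Setoid V}
    (h : Trigraph.IsMerge P Q) : Nat.card (Quotient P) = Nat.card (Quotient Q) + 1 := by
  classical
  have hle := h.le
  obtain ⟨x, y, hxy, hQ⟩ := h
  let f : {U : Quotient P // U ≠ Quotient.mk P y} → Quotient Q :=
    fun U => Quotient.map' id (fun a b hab => hle hab) U.1
  have hf : Function.Bijective f := by
    constructor
    · rintro ⟨U, hU⟩ ⟨W, hW⟩ hUW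
      induction U using Quotient.inductionOn with | _ a => ?_
      induction W using Quotient.inductionOn with | _ b => ?_
      have hab : Q a b := Quotient.exact hUW
      have ha : ¬ P a y := fun h => hU (Quotient.sound h)
      have hb : ¬ P b y := fun h => hW (Quotient.sound h)
      apply Subtype.ext
      apply Quotient.sound
      rcases (hQ a b).1 hab with h | ⟨h, h'⟩
      · exact h
      · exact P.trans (h.resolve_right ha) (P.symm (h'.resolve_right hb))
    · intro W
      induction W using Quotient.inductionOn with | _ b => ?_
      by_cases hb : P b y
      · refine ⟨⟨Quotient.mk P x, fun h => hxy (Quotient.exact h)⟩, ?_⟩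
        exact Quotient.sound ((hQ x b).2 (Or.inr ⟨Or.inl (P.refl x), Or.inr hb⟩))
      · exact ⟨⟨Quotient.mk P b, fun h => hb (Quotient.exact h)⟩, rfl⟩
  rw [← Nat.card_congr (Equiv.ofBijective f hf), ← Finite.card_option]
  exact Nat.card_congr (Equiv.optionSubtypeNe _).symm

/-- `Q` arises from `P` by a series of merges all of whose outcomes satisfy `good`. -/
def Setoid.Contracts {V : Type u} (good : Setoid V → Prop) : Setoid V → Setoid V → Prop :=
  Relation.ReflTransGen (fun P Q => Trigraph.IsMerge P Q ∧ good Q)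

/-- Keep merging two parts that lie in a common part of `Q`: the chain never leaves the interval
from `P` to `Q`, so goodness is only needed there. -/
theorem Setoid.contracts_of_le {V : Type u} [Finite V] {good : Setoid V → Prop}
    {P Q : Setoid V} (hPQ : P ≤ Q) (h : ∀ R, P ≤ R → R ≤ Q → good R) :
    Setoid.Contracts good P Q := by
  induction hn : Nat.card (Quotient P) using Nat.strong_induction_on generalizing P with
  | _ n ih =>
    by_cases hQP : Q ≤ P
    · rw [le_antisymm hPQ hQP]
      exact Relation.ReflTransGen.refl
    · obtain ⟨x, y, hQ, hP⟩ : ∃ x y, Q x y ∧ ¬ P x y := by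
        by_contra! hc
        exact hQP (fun {a b} hab => hc a b hab)
      have hm := Trigraph.isMerge_mergeParts hP
      have hle := Setoid.mergeParts_le hPQ hQ
      refine Relation.ReflTransGen.head ⟨hm, h _ hm.le hle⟩ ?_
      refine ih _ ?_ hle (fun R h1 h2 => h R (hm.le.trans h1) h2) rfl
      have := hm.card_quotient
      omega

theorem Nat.card_quotient_bot {V : Type u} [Finite V] :
    Nat.card (Quotient (⊥ : Setoid V)) = Nat.card V :=
  (Nat.card_congr (Equiv.ofBijective (Quotient.mk (⊥ : Setoid V))
    ⟨fun _ _ h => Quotient.exact h, Quotient.mk_surjective⟩)).symm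

/-- Each merge lowers the number of parts by one, so that number serves as the index required by
`Trigraph.IsPartitionSequence`. -/
theorem Setoid.Contracts.exists_sequence {V : Type u} [Fintype V] {good : Setoid V → Prop}
    {Q : Setoid V} (h : Setoid.Contracts good ⊥ Q) (hbot : good ⊥) :
    ∃ P : ℕ → Setoid V, P (Fintype.card V) = ⊥ ∧ P (Nat.card (Quotient Q)) = Q ∧
      Nat.card (Quotient Q) ≤ Fintype.card V ∧
      (∀ i, Nat.card (Quotient Q) ≤ i → i < Fintype.card V →
        Trigraph.IsMerge (P (i + 1)) (P i)) ∧
      ∀ i, Nat.card (Quotient Q) ≤ i → i ≤ Fintype.card V → good (P i) := by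
  induction h with
  | refl =>
    rw [Nat.card_quotient_bot, Nat.card_eq_fintype_card]
    exact ⟨fun _ => ⊥, rfl, rfl, le_rfl, fun i h1 h2 => by omega, fun i _ _ => hbot⟩
  | @tail R Q _ hRQ ih =>
    obtain ⟨P, h0, h1, h2, h3, h4⟩ := ih
    have hc := hRQ.1.card_quotient
    refine ⟨Function.update P (Nat.card (Quotient Q)) Q, ?_, ?_, by omega, ?_, ?_⟩
    · rw [Function.update_of_ne (by omega), h0]
    · rw [Function.update_self]
    · intro i hi hin
      rw [Function.update_of_ne (by omega)]
      rcases hi.eq_or_lt with rfl | hi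
      · rw [Function.update_self, ← hc, h1]
        exact hRQ.1
      · rw [Function.update_of_ne (by omega)]
        exact h3 i (by omega) hin
    · intro i hi hin
      rcases hi.eq_or_lt with rfl | hi
      · rw [Function.update_self]
        exact hRQ.2
      · rw [Function.update_of_ne (by omega)]
        exact h4 i (by omega) hin

theorem Nat.card_quotient_top {V : Type u} [Nonempty V] :
    Nat.card (Quotient (⊤ : Setoid V)) = 1 := by
  rw [Nat.card_eq_one_iff_unique]
  refine ⟨⟨fun a b => ?_⟩, Nonempty.map (Quotient.mk ⊤) inferInstance⟩
  induction a using Quotient.inductionOn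
  induction b using Quotient.inductionOn
  exact Quotient.sound trivial

theorem Trigraph.IsPartitionSequence.contracts {V : Type u} [Fintype V] [Nonempty V]
    {good : Setoid V → Prop} {P : ℕ → Setoid V} (hP : Trigraph.IsPartitionSequence P)
    (hgood : ∀ i, 1 ≤ i → i ≤ Fintype.card V → good (P i)) :
    Setoid.Contracts good ⊥ ⊤ := by
  have hpos : 0 < Fintype.card V := Fintype.card_pos
  have key : ∀ j, j < Fintype.card V → Setoid.Contracts good ⊥ (P (Fintype.card V - j)) ∧
      Nat.card (Quotient (P (Fintype.card V - j))) = Fintype.card V - j := by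
    intro j
    induction j with
    | zero =>
      intro _
      rw [Nat.sub_zero, hP.1, Nat.card_quotient_bot, Nat.card_eq_fintype_card]
      exact ⟨Relation.ReflTransGen.refl, rfl⟩
    | succ j ih =>
      intro hj
      obtain ⟨h1, h2⟩ := ih (by omega)
      have hm := hP.2 (Fintype.card V - (j + 1)) (by omega) (by omega)
      rw [show Fintype.card V - (j + 1) + 1 = Fintype.card V - j by omega] at hm
      refine ⟨h1.tail ⟨hm, hgood _ (by omega) (by omega)⟩, ?_⟩
      have := hm.card_quotient
      omega
  obtain ⟨h1, h2⟩ := key (Fintype.card V - 1) (by omega)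
  rw [show Fintype.card V - (Fintype.card V - 1) = 1 by omega] at h1 h2
  have htop : P 1 = ⊤ := by
    rw [Nat.card_eq_one_iff_unique] at h2
    have := h2.1
    exact Setoid.ext fun a b => ⟨fun _ => trivial,
      fun _ => Quotient.exact (Subsingleton.elim (Quotient.mk (P 1) a) (Quotient.mk (P 1) b))⟩
  rwa [htop] at h1

theorem Trigraph.exists_isPartitionSequence (V : Type u) [Fintype V] [Nonempty V] :
    ∃ P : ℕ → Setoid V, Trigraph.IsPartitionSequence P := by
  obtain ⟨P, h0, -, -, h3, -⟩ := (Setoid.contracts_of_le (good := fun _ => True)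
    (bot_le : (⊥ : Setoid V) ≤ ⊤) (fun _ _ _ => trivial)).exists_sequence trivial
  rw [Nat.card_quotient_top] at h3
  exact ⟨P, h0, h3⟩

/-- This lets a contraction of a quotient continue a contraction of `V` that has reached `O`. -/
theorem Setoid.Contracts.comap_mk {V : Type u} {O : Setoid V}
    {good : Setoid (Quotient O) → Prop} {good' : Setoid V → Prop}
    (hgood : ∀ R, good R → good' (R.comap (Quotient.mk O))) {P Q : Setoid (Quotient O)}
    (h : Setoid.Contracts good P Q) :
    Setoid.Contracts good' (P.comap (Quotient.mk O)) (Q.comap (Quotient.mk O)) := by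
  refine Relation.ReflTransGen.lift (Setoid.comap (Quotient.mk O)) ?_ _ _ h
  rintro R S ⟨⟨x, y, hxy, hS⟩, hg⟩
  refine ⟨?_, hgood _ hg⟩
  induction x using Quotient.inductionOn with | _ x => ?_
  induction y using Quotient.inductionOn with | _ y => ?_
  exact ⟨x, y, hxy, fun a b => hS _ _⟩

/-! ### Total degree in place of red degree -/

/-- The quotient graph of `G` by `P`, with two parts adjacent if some edge joins them. -/
def SimpleGraph.quotientGraph {V : Type u} (G : SimpleGraph V) (P : Setoid V) :
    SimpleGraph (Quotient P) :=
  (G.toTrigraph.quotient P).graph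

theorem SimpleGraph.quotientGraph_adj {V : Type u} {G : SimpleGraph V} {P : Setoid V} {a b : V} :
    (G.quotientGraph P).Adj (Quotient.mk P a) (Quotient.mk P b) ↔
      ¬ P a b ∧ ∃ v w, P v a ∧ P w b ∧ G.Adj v w := by
  constructor
  · rintro ⟨h, h'⟩
    refine ⟨fun hab => h (Quotient.sound hab), ?_⟩
    by_contra! hc
    exact h' fun v hv w hw hvw => hc v w (Quotient.exact hv) (Quotient.exact hw) hvw
  · rintro ⟨h, v, w, hv, hw, hvw⟩
    exact ⟨fun hab => h (Quotient.exact hab),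
      fun hd => hd v (Quotient.sound hv) w (Quotient.sound hw) hvw⟩

/-- Every part of `P` is adjacent to fewer than `k` other parts. -/
def SimpleGraph.QuotientDegreeLT {V : Type u} (G : SimpleGraph V) (k : ℕ) (P : Setoid V) : Prop :=
  ∀ U, ((G.quotientGraph P).neighborSet U).ncard < k

/-- Red degree fails here: deleting edges can turn a black edge of the quotient red. -/
theorem SimpleGraph.QuotientDegreeLT.mono {V : Type u} [Finite V] {G H : SimpleGraph V}
    (hGH : G ≤ H) {k : ℕ} {P : Setoid V} (h : H.QuotientDegreeLT k P) :
    G.QuotientDegreeLT k P := by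
  intro U
  refine lt_of_le_of_lt (Set.ncard_le_ncard ?_ (Set.toFinite _)) (h U)
  intro W hW
  induction U using Quotient.inductionOn with | _ a => ?_
  induction W using Quotient.inductionOn with | _ b => ?_
  obtain ⟨hab, v, w, hv, hw, hvw⟩ := quotientGraph_adj.1 hW
  exact quotientGraph_adj.2 ⟨hab, v, w, hv, hw, hGH hvw⟩

theorem SimpleGraph.QuotientDegreeLT.comap_mk {V : Type u} [Finite V] {G : SimpleGraph V}
    {O : Setoid V} {k : ℕ} {R : Setoid (Quotient O)}
    (h : (G.quotientGraph O).QuotientDegreeLT k R) :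
    G.QuotientDegreeLT k (R.comap (Quotient.mk O)) := by
  intro U
  let f : Quotient (R.comap (Quotient.mk O)) → Quotient R :=
    Quotient.map' (Quotient.mk O) (fun _ _ hab => hab)
  have hf : Function.Injective f := by
    intro A B hAB
    induction A using Quotient.inductionOn with | _ a => ?_
    induction B using Quotient.inductionOn with | _ b => ?_
    have h1 : R (Quotient.mk O a) (Quotient.mk O b) := Quotient.exact hAB
    exact Quotient.sound h1
  rw [← Set.ncard_image_of_injective _ hf]
  refine lt_of_le_of_lt (Set.ncard_le_ncard ?_ (Set.toFinite _)) (h (f U))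
  rintro _ ⟨W, hW, rfl⟩
  induction U using Quotient.inductionOn with | _ a => ?_
  induction W using Quotient.inductionOn with | _ b => ?_
  obtain ⟨hab, v, w, hv, hw, hvw⟩ := quotientGraph_adj.1 hW
  refine quotientGraph_adj.2 ⟨hab, Quotient.mk O v, Quotient.mk O w, hv, hw, ?_⟩
  refine quotientGraph_adj.2 ⟨fun hO => hab ?_, v, w, O.refl _, O.refl _, hvw⟩
  have h1 : R (Quotient.mk O v) (Quotient.mk O w) := by
    rw [Quotient.sound hO]
  exact R.trans (R.symm hv) (R.trans h1 hw)

theorem SimpleGraph.quotientDegreeLT_of_card_le {V : Type u} [Finite V] {G : SimpleGraph V}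
    {k : ℕ} (h : Nat.card V ≤ k) (P : Setoid V) : G.QuotientDegreeLT k P := by
  intro U
  have h1 : Nat.card (Quotient P) ≤ Nat.card V := Nat.card_le_card_of_surjective _ Quotient.mk_surjective
  have h2 : ((G.quotientGraph P).neighborSet U).ncard < Nat.card (Quotient P) := by
    rw [← Set.ncard_univ]
    refine Set.ncard_lt_ncard ?_ (Set.toFinite _)
    rw [Set.ssubset_univ_iff]
    intro hU
    exact (G.quotientGraph P).irrefl (show U ∈ (G.quotientGraph P).neighborSet U by
      rw [hU]; trivial)
  omega

theorem SimpleGraph.quotientDegreeLT_bot {V : Type u} [Finite V] {G : SimpleGraph V}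
    {d k : ℕ} (hd : ∀ v, (G.neighborSet v).ncard ≤ d) (hk : d < k) : G.QuotientDegreeLT k ⊥ := by
  intro U
  induction U using Quotient.inductionOn with | _ a => ?_
  refine lt_of_le_of_lt (le_trans (le_trans (Set.ncard_le_ncard (t := Quotient.mk ⊥ '' G.neighborSet a)
    ?_ (Set.toFinite _)) (Set.ncard_image_le (Set.toFinite _))) (hd a)) hk
  intro W hW
  induction W using Quotient.inductionOn with | _ b => ?_
  obtain ⟨-, v, w, hv, hw, hvw⟩ := quotientGraph_adj.1 hW
  obtain rfl : v = a := hv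
  obtain rfl : w = b := hw
  exact ⟨w, hvw, rfl⟩

theorem SimpleGraph.twinWidth_lt_of_contracts {V : Type u} [Fintype V] [Nonempty V]
    {G : SimpleGraph V} {k : ℕ} (hbot : G.QuotientDegreeLT k ⊥)
    (h : Setoid.Contracts (G.QuotientDegreeLT k) ⊥ ⊤) : G.twinWidth < k := by
  obtain ⟨P, h0, -, -, h3, h4⟩ := h.exists_sequence hbot
  rw [Nat.card_quotient_top] at h3 h4
  have hk : 0 < k := lt_of_le_of_lt (Nat.zero_le _) (hbot (Quotient.mk _ (Classical.arbitrary V)))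
  -- Width is a non-strict bound, hence `k - 1`; `0 < k` makes this honest.
  refine lt_of_le_of_lt (Nat.sInf_le (m := k - 1) ⟨P, ⟨h0, h3⟩, ?_⟩) (by omega)
  intro i hi hin U
  have hU := h4 i hi hin U
  have : (G.toTrigraph.quotient (P i)).redDegree U
      ≤ ((G.quotientGraph (P i)).neighborSet U).ncard :=
    Set.ncard_le_ncard (fun W hW => (G.toTrigraph.quotient (P i)).red_le hW) (Set.toFinite _)
  omega

/-- If a part has more than `d ^ 2` neighbours, then all edges at it are red. -/
theorem SimpleGraph.ncard_neighborSet_quotientGraph_le {V : Type u} [Finite V]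
    {G : SimpleGraph V} {d : ℕ} (hd : ∀ v, (G.neighborSet v).ncard ≤ d) (P : Setoid V)
    (U : Quotient P) : ((G.quotientGraph P).neighborSet U).ncard ≤
      max (d ^ 2) ((G.toTrigraph.quotient P).redDegree U) := by
  classical
  have := Fintype.ofFinite V
  by_contra! hlt
  rw [max_lt_iff] at hlt
  obtain ⟨hlt, hred⟩ := hlt
  induction U using Quotient.inductionOn with | _ a => ?_
  have hsub : (G.quotientGraph P).neighborSet (Quotient.mk P a) ⊆
      ⋃ v ∈ (Finset.univ.filter fun v => P v a), Quotient.mk P '' G.neighborSet v := by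
    intro W hW
    induction W using Quotient.inductionOn with | _ b => ?_
    obtain ⟨-, v, w, hv, hw, hvw⟩ := quotientGraph_adj.1 hW
    simp only [Set.mem_iUnion]
    exact ⟨v, by simpa using hv, w, hvw, Quotient.sound hw⟩
  have hcard : ((G.quotientGraph P).neighborSet (Quotient.mk P a)).ncard ≤
      (Finset.univ.filter fun v => P v a).card * d := by
    refine (Set.ncard_le_ncard hsub (Set.toFinite _)).trans
      ((Finset.set_ncard_biUnion_le _ _).trans ?_)
    rw [← smul_eq_mul]
    exact Finset.sum_le_card_nsmul _ _ _
      fun v _ => (Set.ncard_image_le (Set.toFinite _)).trans (hd v)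
  -- Each vertex of the part accounts for at most `d` neighbouring parts, and there are more than `d
  -- ^ 2` of these.
  have hbig : d < (Finset.univ.filter fun v => P v a).card := by
    by_contra! hc
    have := Nat.mul_le_mul_right d hc
    rw [sq] at hlt
    omega
  -- A black edge to the part of `b` would make `b` adjacent to all of these more than `d` vertices.
  refine absurd (Set.ncard_le_ncard (fun W hW => ?_) (Set.toFinite _)) (not_le.2 hred)
  refine ⟨hW.1, hW.2, fun hfull => ?_⟩
  induction W using Quotient.inductionOn with | _ b => ?_
  have hsub' : ((Finset.univ.filter fun v => P v a : Finset V) : Set V) ⊆ G.neighborSet b := by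
    intro v hv
    have hv : P v a := by simpa using hv
    exact (hfull v (Quotient.sound hv) b rfl).1.symm
  have := Set.ncard_le_ncard hsub' (Set.toFinite _)
  rw [Set.ncard_coe_finset] at this
  have := hd b
  omega

theorem SimpleGraph.contracts_of_twinWidth_lt {V : Type u} [Fintype V] [Nonempty V]
    {G : SimpleGraph V} {d k : ℕ} (hd : ∀ v, (G.neighborSet v).ncard ≤ d) (hk : d ^ 2 < k)
    (h : G.twinWidth < k) : Setoid.Contracts (G.QuotientDegreeLT k) ⊥ ⊤ := by
  -- `sInf ∅ = 0`, so nonemptiness is needed before the infimum yields a sequence.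
  have hne : {k : ℕ | ∃ P : ℕ → Setoid V, Trigraph.IsPartitionSequence P ∧
      G.toTrigraph.WidthAtMost P k}.Nonempty := by
    obtain ⟨P, hP⟩ := Trigraph.exists_isPartitionSequence V
    refine ⟨Nat.card V, P, hP, fun i _ _ U => ?_⟩
    calc (G.toTrigraph.quotient (P i)).redDegree U ≤ Nat.card (Quotient (P i)) := by
          rw [← Set.ncard_univ]
          exact Set.ncard_le_ncard (Set.subset_univ _) (Set.toFinite _)
      _ ≤ Nat.card V := Nat.card_le_card_of_surjective _ Quotient.mk_surjective
  obtain ⟨P, hP, hw⟩ := Nat.sInf_mem hne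
  refine hP.contracts fun i hi hin U => ?_
  have h1 := ncard_neighborSet_quotientGraph_le hd (P i) U
  have h2 : (G.toTrigraph.quotient (P i)).redDegree U ≤ G.twinWidth := hw i hi hin U
  exact lt_of_le_of_lt h1 (max_lt hk (lt_of_le_of_lt h2 h))

/-- A graph of maximum degree at most `d` on more than `d` vertices is contained in one of
maximum degree exactly `d`. -/
theorem SimpleGraph.exists_le_maxDegree_eq {V : Type u} [Finite V] {G : SimpleGraph V}
    {d : ℕ} (hd : ∀ v, (G.neighborSet v).ncard ≤ d) (hV : d < Nat.card V) :
    ∃ H, G ≤ H ∧ (∀ v, (H.neighborSet v).ncard ≤ d) ∧ ∃ v, (H.neighborSet v).ncard = d := by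
  obtain ⟨H, hGH, hH⟩ := (Set.toFinite
    {H : SimpleGraph V | ∀ v, (H.neighborSet v).ncard ≤ d}).exists_le_maximal hd
  refine ⟨H, hGH, hH.prop, ?_⟩
  by_contra! hne
  have hlt : ∀ v, (H.neighborSet v).ncard < d := fun v => lt_of_le_of_ne (hH.prop v) (hne v)
  -- If all degrees are below `d`, any missing edge could be added, so maximality makes `H`
  -- complete; but then its degrees are at least `d`.
  have hcomplete : ∀ v w, v ≠ w → H.Adj v w := by
    intro v w hvw
    have hle : H ⊔ SimpleGraph.edge v w ≤ H := by
      refine hH.le_of_ge (fun x => ?_) le_sup_left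
      have hsub : (H ⊔ SimpleGraph.edge v w).neighborSet x ⊆
          insert (open Classical in if x = v then w else v) (H.neighborSet x) := by
        intro y hy
        rcases hy with hy | hy
        · exact Or.inr hy
        · rw [SimpleGraph.edge_adj] at hy
          left
          split_ifs <;> aesop
      have := (Set.ncard_le_ncard hsub (Set.toFinite _)).trans (Set.ncard_insert_le _ _)
      have := hlt x
      omega
    exact hle (Or.inr ((SimpleGraph.edge_adj ..).2 ⟨Or.inl ⟨rfl, rfl⟩, hvw⟩))
  have : Nonempty V := (Nat.card_pos_iff.1 (by omega)).1
  obtain ⟨v⟩ := this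
  have h1 : insert v (H.neighborSet v) = Set.univ := by
    ext w
    simp only [Set.mem_insert_iff, Set.mem_univ, iff_true]
    by_cases h : v = w
    · exact Or.inl h.symm
    · exact Or.inr (hcomplete v w h)
  have h2 := Set.ncard_insert_le v (H.neighborSet v)
  rw [h1, Set.ncard_univ] at h2
  have := hlt v
  omega

/-! ### Blocks of consecutive points on cycles -/

/-- A window of `2 * L` positions meets at most three blocks if it does not wrap around. Wrapping
can add one more, because the last block of the cycle may be shorter than `L`. Cycles shorter than
`2 * L` have at most two blocks. -/
theorem Nat.card_image_cyclic_window_le_four {b m L : ℕ} (hb : b < m) (hL : 0 < L) :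
    ((Finset.range (2 * L)).image fun i => (b + i) % m / L).card ≤ 4 := by
  rcases lt_or_ge m (2 * L) with hm | hm
  · have hsub : ((Finset.range (2 * L)).image fun i => (b + i) % m / L) ⊆ Finset.range 2 := by
      intro t ht
      obtain ⟨i, -, rfl⟩ := Finset.mem_image.1 ht
      rw [Finset.mem_range, Nat.div_lt_iff_lt_mul hL]
      exact (Nat.mod_lt _ (by omega)).trans hm
    exact (Finset.card_le_card hsub).trans (by simp)
  · have hsub : ((Finset.range (2 * L)).image fun i => (b + i) % m / L) ⊆
        if b + 2 * L ≤ m then Finset.Icc (b / L) ((b + 2 * L - 1) / L) else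
          Finset.Icc (b / L) ((m - 1) / L) ∪ Finset.Icc 0 ((b + 2 * L - 1 - m) / L) := by
      intro t ht
      obtain ⟨i, hi, rfl⟩ := Finset.mem_image.1 ht
      rw [Finset.mem_range] at hi
      split_ifs with h
      · rw [Nat.mod_eq_of_lt (by omega), Finset.mem_Icc]
        exact ⟨Nat.div_le_div_right (by omega), Nat.div_le_div_right (by omega)⟩
      · rw [Finset.mem_union]
        rcases lt_or_ge (b + i) m with h' | h'
        · left
          rw [Nat.mod_eq_of_lt h', Finset.mem_Icc]
          exact ⟨Nat.div_le_div_right (by omega), Nat.div_le_div_right (by omega)⟩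
        · right
          rw [Nat.mod_eq_sub_mod h', Nat.mod_eq_of_lt (by omega), Finset.mem_Icc]
          exact ⟨Nat.zero_le _, Nat.div_le_div_right (by omega)⟩
    refine (Finset.card_le_card hsub).trans ?_
    have hbL := Nat.lt_mul_div_succ b hL
    split_ifs with h
    · rw [Nat.card_Icc]
      have : (b + 2 * L - 1) / L < b / L + 3 := by
        rw [Nat.div_lt_iff_lt_mul hL]
        linarith [Nat.sub_le (b + 2 * L) 1]
      omega
    · refine (Finset.card_union_le _ _).trans ?_
      rw [Nat.card_Icc, Nat.card_Icc]
      have h1 := Nat.mul_div_le (m - 1) L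
      have h2 := Nat.mul_div_le (b + 2 * L - 1 - m) L
      have h3 : L * ((m - 1) / L + (b + 2 * L - 1 - m) / L) < L * (b / L + 3) := by
        have : (m - 1) + (b + 2 * L - 1 - m) + 2 = b + 2 * L := by omega
        linarith
      have h4 := Nat.lt_of_mul_lt_mul_left h3
      have h5 : b / L ≤ (m - 1) / L := Nat.div_le_div_right (by omega)
      generalize (m - 1) / L = p, (b + 2 * L - 1 - m) / L = q, b / L = r at *
      omega

theorem Finset.card_image_le_card_image {α β γ : Type*} [DecidableEq β] [DecidableEq γ]
    (s : Finset α) (f : α → β) (g : α → γ)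
    (h : ∀ a b, g a = g b → f a = f b) : (s.image f).card ≤ (s.image g).card := by
  rcases s.eq_empty_or_nonempty with rfl | ⟨a, -⟩
  · simp
  · have : Nonempty β := ⟨f a⟩
    obtain ⟨e, rfl⟩ := (Function.factorsThrough_iff (f := g) f).1 (fun a b hab => h a b hab)
    rw [← Finset.image_image]
    exact Finset.card_image_le

namespace Equiv.Perm

variable {V : Type u} (σ : Equiv.Perm V)

/-- A chosen point in the cycle of `v`. -/
noncomputable def cycleRep (v : V) : V :=
  (Quotient.mk (SameCycle.setoid σ) v).out

theorem sameCycle_cycleRep (v : V) : σ.SameCycle (σ.cycleRep v) v :=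
  Quotient.mk_out (s := SameCycle.setoid σ) v

variable {σ} in
theorem SameCycle.cycleRep_eq {v w : V} (h : σ.SameCycle v w) : σ.cycleRep v = σ.cycleRep w := by
  unfold cycleRep
  rw [Quotient.sound (s := SameCycle.setoid σ) h]

theorem sameCycle_iterate (i : ℕ) (v : V) : σ.SameCycle v (σ^[i] v) :=
  ⟨i, by rw [Equiv.Perm.iterate_eq_pow, zpow_natCast]⟩

variable [Finite V]

theorem minimalPeriod_pos (v : V) : 0 < Function.minimalPeriod σ v :=
  Function.minimalPeriod_pos_of_mem_periodicPts
    (Function.Injective.mem_periodicPts σ.injective v)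

theorem exists_iterate_cycleRep (v : V) :
    ∃ i < Function.minimalPeriod σ (σ.cycleRep v), σ^[i] (σ.cycleRep v) = v := by
  obtain ⟨i, hi⟩ := (σ.sameCycle_cycleRep v).exists_nat_pow_eq
  refine ⟨i % Function.minimalPeriod σ (σ.cycleRep v), Nat.mod_lt _ (σ.minimalPeriod_pos _), ?_⟩
  rw [Function.iterate_mod_minimalPeriod_eq, Equiv.Perm.iterate_eq_pow, hi]

/-- The position of `v` on its cycle, counted from the chosen point. -/
noncomputable def cycleIndex (v : V) : ℕ :=
  (σ.exists_iterate_cycleRep v).choose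

theorem cycleIndex_lt (v : V) : σ.cycleIndex v < Function.minimalPeriod σ (σ.cycleRep v) :=
  (σ.exists_iterate_cycleRep v).choose_spec.1

theorem iterate_cycleIndex (v : V) : σ^[σ.cycleIndex v] (σ.cycleRep v) = v :=
  (σ.exists_iterate_cycleRep v).choose_spec.2

theorem cycleIndex_iterate (i : ℕ) (v : V) : σ.cycleIndex (σ^[i] v) =
    (σ.cycleIndex v + i) % Function.minimalPeriod σ (σ.cycleRep v) := by
  have hrep := (σ.sameCycle_iterate i v).cycleRep_eq
  have hlt := σ.cycleIndex_lt (σ^[i] v)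
  rw [← hrep] at hlt
  rw [← Function.iterate_eq_iterate_iff_of_lt_minimalPeriod hlt
    (Nat.mod_lt _ (σ.minimalPeriod_pos _)), Function.iterate_mod_minimalPeriod_eq, add_comm,
    Function.iterate_add_apply, iterate_cycleIndex]
  conv_lhs => rw [hrep, iterate_cycleIndex]

/-- The partition of every cycle of `σ` into blocks of `L` consecutive points. -/
noncomputable def blockSetoid (L : ℕ) : Setoid V where
  r a b := σ.SameCycle a b ∧ σ.cycleIndex a / L = σ.cycleIndex b / L
  iseqv :=
    { refl := fun a => ⟨SameCycle.refl σ a, rfl⟩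
      symm := fun h => ⟨h.1.symm, h.2.symm⟩
      trans := fun h g => ⟨h.1.trans g.1, h.2.trans g.2⟩ }

theorem blockSetoid_one : σ.blockSetoid 1 = ⊥ := by
  ext a b
  constructor
  · rintro ⟨h, h'⟩
    rw [Nat.div_one, Nat.div_one] at h'
    have ha := σ.iterate_cycleIndex a
    rw [h.cycleRep_eq, h', iterate_cycleIndex] at ha
    exact ha.symm
  · rintro rfl
    exact (σ.blockSetoid 1).refl _

theorem blockSetoid_le_mul_two (L : ℕ) : σ.blockSetoid L ≤ σ.blockSetoid (2 * L) := by
  rintro a b ⟨h, h'⟩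
  refine ⟨h, ?_⟩
  rw [mul_comm, ← Nat.div_div_eq_div_mul, h', Nat.div_div_eq_div_mul]

theorem blockSetoid_of_card_le {L : ℕ} (hL : Nat.card V ≤ L) :
    σ.blockSetoid L = SameCycle.setoid σ := by
  have hlt : ∀ v, σ.cycleIndex v < L := fun v => by
    have := Fintype.ofFinite V
    refine lt_of_lt_of_le ((σ.cycleIndex_lt v).trans_le ?_) hL
    rw [Nat.card_eq_fintype_card]
    exact Function.minimalPeriod_le_card
  ext a b
  exact ⟨fun h => h.1, fun h => ⟨h, by rw [Nat.div_eq_of_lt (hlt a), Nat.div_eq_of_lt (hlt b)]⟩⟩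

end Equiv.Perm

/-! ### Contracting the cycles of an automorphism -/

section CyclicContraction

open Equiv.Perm

/-- A part of `R` lies in a block `x, σ x, σ² x, …` of at most `2 * L` points. The neighbours of `σⁱ
x` are the `σⁱ w` with `w` adjacent to `x`, so all neighbours lie in at most `d` windows of length
`2 * L`. Each window meets at most four blocks of length `L`, hence at most four parts. -/
theorem SimpleGraph.quotientDegreeLT_of_blockSetoid {V : Type u} [Finite V] {G : SimpleGraph V}
    {d k : ℕ} (hd : ∀ v, (G.neighborSet v).ncard ≤ d) (hk : 4 * d < k) (σ : G ≃g G) {L : ℕ}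
    (hL : 0 < L) {R : Setoid V} (h1 : blockSetoid σ.toEquiv L ≤ R)
    (h2 : R ≤ blockSetoid σ.toEquiv (2 * L)) : G.QuotientDegreeLT k R := by
  classical
  have := Fintype.ofFinite V
  set τ : Equiv.Perm V := σ.toEquiv with hτ
  have hadj : ∀ (i : ℕ) (v w : V), G.Adj (τ^[i] v) (τ^[i] w) ↔ G.Adj v w := by
    intro i
    induction i with
    | zero => exact fun v w => Iff.rfl
    | succ i ih =>
      intro v w
      rw [Function.iterate_succ_apply, Function.iterate_succ_apply, ih]
      exact σ.map_adj_iff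
  intro U
  induction U using Quotient.inductionOn with | _ a => ?_
  -- The first point of the block of length `2 * L` containing `a`.
  set x := τ^[2 * L * (τ.cycleIndex a / (2 * L))] (τ.cycleRep a) with hx
  have hblock : ∀ v, R v a → ∃ i < 2 * L, τ^[i] x = v := by
    intro v hv
    obtain ⟨hc, he⟩ := h2 hv
    refine ⟨τ.cycleIndex v % (2 * L), Nat.mod_lt _ (by omega), ?_⟩
    rw [hx, ← Function.iterate_add_apply, ← he, Nat.mod_add_div, ← hc.cycleRep_eq,
      iterate_cycleIndex]
  have hsub : (G.quotientGraph R).neighborSet (Quotient.mk R a) ⊆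
      ⋃ w ∈ (Finset.univ.filter fun w => G.Adj x w),
        (((Finset.range (2 * L)).image fun i => Quotient.mk R (τ^[i] w) : Finset _) : Set _) := by
    intro W hW
    induction W using Quotient.inductionOn with | _ b => ?_
    obtain ⟨-, v, z, hv, hz, hvz⟩ := quotientGraph_adj.1 hW
    obtain ⟨i, hi, rfl⟩ := hblock v hv
    obtain ⟨w, rfl⟩ := (τ.bijective.iterate i).2 z
    simp only [Set.mem_iUnion]
    refine ⟨w, by simpa using (hadj i x w).1 hvz, ?_⟩
    rw [Finset.mem_coe, Finset.mem_image]
    exact ⟨i, Finset.mem_range.2 hi, Quotient.sound hz⟩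
  refine lt_of_le_of_lt ?_ hk
  refine (Set.ncard_le_ncard hsub (Set.toFinite _)).trans
      ((Finset.set_ncard_biUnion_le _ _).trans ?_)
  have hfour : ∀ w, (((Finset.range (2 * L)).image
      fun i => Quotient.mk R (τ^[i] w) : Finset (Quotient R)) : Set (Quotient R)).ncard ≤ 4 := by
    intro w
    rw [Set.ncard_coe_finset]
    refine (Finset.card_image_le_card_image _ _
      (fun i => (τ.cycleIndex w + i) % Function.minimalPeriod τ (τ.cycleRep w) / L)
      fun i j hij => ?_).trans (Nat.card_image_cyclic_window_le_four (τ.cycleIndex_lt w) hL)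
    refine Quotient.sound (h1 ⟨(τ.sameCycle_iterate i w).symm.trans (τ.sameCycle_iterate j w), ?_⟩)
    rw [cycleIndex_iterate, cycleIndex_iterate]
    exact hij
  refine (Finset.sum_le_card_nsmul _ _ 4 fun w _ => hfour w).trans ?_
  have : (Finset.univ.filter fun w => G.Adj x w).card ≤ d := by
    rw [← Set.ncard_coe_finset]
    refine le_trans (le_of_eq ?_) (hd x)
    congr 1
    ext w
    simp
  rw [smul_eq_mul]
  omega

theorem SimpleGraph.contracts_sameCycle {V : Type u} [Finite V] {G : SimpleGraph V}
    {d k : ℕ} (hd : ∀ v, (G.neighborSet v).ncard ≤ d) (hk : 4 * d < k) (σ : G ≃g G) :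
    Setoid.Contracts (G.QuotientDegreeLT k) ⊥ (SameCycle.setoid σ.toEquiv) := by
  have key : ∀ j, Setoid.Contracts (G.QuotientDegreeLT k) ⊥ (blockSetoid σ.toEquiv (2 ^ j)) := by
    intro j
    induction j with
    | zero =>
      rw [pow_zero, blockSetoid_one]
      exact Relation.ReflTransGen.refl
    | succ j ih =>
      rw [pow_succ, mul_comm]
      exact ih.trans (Setoid.contracts_of_le (blockSetoid_le_mul_two _ _)
        fun R h1 h2 => quotientDegreeLT_of_blockSetoid hd hk σ (by positivity) h1 h2)
  have h := key (Nat.card V)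
  rwa [blockSetoid_of_card_le _ Nat.lt_two_pow_self.le] at h

/-- A power of `σ` moves any edge leaving the cycle of `a` to an edge at `a` itself, without
changing the cycle at the other end. -/
theorem SimpleGraph.ncard_neighborSet_quotientGraph_sameCycle_le {V : Type u} [Finite V]
    {G : SimpleGraph V} {d : ℕ} (hd : ∀ v, (G.neighborSet v).ncard ≤ d) (σ : G ≃g G)
    (U : Quotient (SameCycle.setoid σ.toEquiv)) :
    ((G.quotientGraph (SameCycle.setoid σ.toEquiv)).neighborSet U).ncard ≤ d := by
  induction U using Quotient.inductionOn with | _ a => ?_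
  refine (Set.ncard_le_ncard (t := Quotient.mk _ '' G.neighborSet a) ?_ (Set.toFinite _)).trans
    ((Set.ncard_image_le (Set.toFinite _)).trans (hd a))
  intro W hW
  induction W using Quotient.inductionOn with | _ b => ?_
  obtain ⟨-, v, w, hv, hw, hvw⟩ := quotientGraph_adj.1 hW
  have hadj : ∀ (i : ℕ) (v w : V), G.Adj v w → G.Adj ((σ.toEquiv ^ i) v) ((σ.toEquiv ^ i) w) := by
    intro i
    induction i with
    | zero => exact fun v w h => h
    | succ i ih =>
      intro v w h
      rw [pow_succ]
      exact ih _ _ (σ.map_adj_iff.2 h)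
  obtain ⟨i, rfl⟩ := SameCycle.exists_nat_pow_eq hv
  refine ⟨_, hadj i _ _ hvw, Quotient.sound ?_⟩
  refine SameCycle.trans ?_ hw
  exact SameCycle.symm ⟨i, rfl⟩

/-- If all graphs of maximum degree `d` on fewer than `n - ℓ` vertices have smaller twin-width,
then every automorphism has at least `n - ℓ` cycles. -/
theorem SimpleGraph.card_le_card_sameCycle_add {V : Type u} [Fintype V] {G : SimpleGraph V}
    {d k ℓ : ℕ} (hd : ∀ v, (G.neighborSet v).ncard ≤ d) (hk : max (4 * d) (d ^ 2) < k)
    (hG : k ≤ G.twinWidth)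
    (hmin : ∀ (W : Type u) [Fintype W] (H : SimpleGraph W), (∀ v, (H.neighborSet v).ncard ≤ d) →
      (∃ v, (H.neighborSet v).ncard = d) → Fintype.card W + ℓ < Fintype.card V →
      H.twinWidth < k) (σ : G ≃g G) :
    Nat.card V ≤ Nat.card (Quotient (SameCycle.setoid σ.toEquiv)) + ℓ := by
  classical
  by_contra! hlt
  obtain ⟨hk4, hk2⟩ := max_lt_iff.1 hk
  have hV : Nonempty V := (Nat.card_pos_iff.1 (by omega)).1
  set O := SameCycle.setoid σ.toEquiv
  have : Nonempty (Quotient O) := hV.map (Quotient.mk O)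
  have hdO : ∀ U, ((G.quotientGraph O).neighborSet U).ncard ≤ d :=
    ncard_neighborSet_quotientGraph_sameCycle_le hd σ
  have hO : Setoid.Contracts ((G.quotientGraph O).QuotientDegreeLT k) ⊥ ⊤ := by
    -- With at most `d` cycles no degree can reach `k`. Otherwise there is room to raise the maximum
    -- degree to exactly `d`, as the hypothesis demands.
    rcases le_or_gt (Nat.card (Quotient O)) d with h | h
    · exact Setoid.contracts_of_le bot_le
        fun R _ _ => quotientDegreeLT_of_card_le (h.trans (by omega)) R
    · obtain ⟨H, hGH, hH, hHd⟩ := exists_le_maxDegree_eq hdO h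
      rw [Nat.card_eq_fintype_card, Nat.card_eq_fintype_card] at hlt
      have h3 := contracts_of_twinWidth_lt hH hk2 (hmin _ H hH hHd hlt)
      exact Relation.ReflTransGen.mono (fun _ _ h => ⟨h.1, h.2.mono hGH⟩) _ _ h3
  have h5 := Setoid.Contracts.comap_mk (good' := G.QuotientDegreeLT k)
    (fun R hR => hR.comap_mk) hO
  have hbot : (⊥ : Setoid (Quotient O)).comap (Quotient.mk O) = O :=
    Setoid.ext fun a b => ⟨fun h => Quotient.exact h, fun h => Quotient.sound h⟩
  rw [hbot] at h5
  have h6 := twinWidth_lt_of_contracts (quotientDegreeLT_bot hd (by omega))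
    ((contracts_sameCycle hd hk4 σ).trans h5)
  omega

end CyclicContraction

/-! ### Counting permutations with many cycles -/

namespace Equiv.Perm

/-- A permutation is determined by a transversal of its cycles and its values off it. -/
theorem eq_of_cycleRep {V : Type u} [Finite V] {σ τ : Equiv.Perm V}
    (h : ∀ v, σ.cycleRep v = v ↔ τ.cycleRep v = v)
    (h' : ∀ v, σ.cycleRep v ≠ v → σ v = τ v) : σ = τ := by
  -- Following `σ` from `x` until it meets the transversal, `σ` and `τ` agree at every step.
  have key : ∀ r, σ.cycleRep r = r → ∀ (j : ℕ) (x : V), (σ ^ j) x = r → τ.SameCycle x r := by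
    intro r hr j
    induction j with
    | zero =>
      rintro x rfl
      exact SameCycle.refl _ _
    | succ j ih =>
      intro x hx
      by_cases hxr : σ.cycleRep x = x
      · have hc : σ.SameCycle x r := ⟨(j + 1 : ℕ), by rw [zpow_natCast, hx]⟩
        rw [← hxr, hc.cycleRep_eq, hr]
      · rw [pow_succ, mul_apply, h' x hxr] at hx
        exact sameCycle_apply_left.1 (ih _ hx)
  ext r
  by_cases hr : σ.cycleRep r = r
  · have hc : σ.SameCycle (σ r) r := sameCycle_apply_left.2 (SameCycle.refl σ r)
    obtain ⟨j, hj⟩ := hc.exists_nat_pow_eq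
    -- Let `y = τ⁻¹ (σ r)`. If `y` is in the transversal, it is `r`, the only such point on its
    -- `τ`-cycle; otherwise `σ y = τ y = σ r`, and again `y = r`.
    have hy : τ.SameCycle (τ.symm (σ r)) r := sameCycle_symm_apply_left.2 (key r hr j _ hj)
    suffices τ.symm (σ r) = r by
      rwa [Equiv.symm_apply_eq] at this
    by_cases hyr : σ.cycleRep (τ.symm (σ r)) = τ.symm (σ r)
    · rw [← (h _).1 hyr, hy.cycleRep_eq, (h r).1 hr]
    · have := h' _ hyr
      rw [apply_symm_apply] at this
      exact σ.injective this
  · exact h' r hr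

section Counting

variable {V : Type u} [Fintype V] [DecidableEq V]

/-- The points outside the chosen transversal of the cycles. -/
noncomputable def nonRep (σ : Equiv.Perm V) : Finset V :=
  Finset.univ.filter fun v => σ.cycleRep v ≠ v

theorem mem_nonRep {σ : Equiv.Perm V} {v : V} : v ∈ σ.nonRep ↔ σ.cycleRep v ≠ v := by
  simp [nonRep]

theorem nonRep_subset_support (σ : Equiv.Perm V) : σ.nonRep ⊆ σ.support := by
  intro v hv
  rw [mem_support]
  intro hfix
  obtain ⟨i, hi⟩ := (σ.sameCycle_cycleRep v).symm
  rw [zpow_apply_eq_self_of_apply_eq_self hfix] at hi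
  exact mem_nonRep.1 hv hi.symm

/-- `σ` maps the moved representatives injectively to non-representatives. -/
theorem card_support_le_two_mul_card_nonRep (σ : Equiv.Perm V) :
    σ.support.card ≤ 2 * σ.nonRep.card := by
  have h : (σ.support \ σ.nonRep).card ≤ σ.nonRep.card := by
    refine Finset.card_le_card_of_injOn σ ?_ σ.injective.injOn
    intro v hv
    rw [Finset.mem_coe, Finset.mem_sdiff, mem_support, mem_nonRep, not_not] at hv
    rw [Finset.mem_coe, mem_nonRep]
    intro hσ
    have hc : σ.SameCycle (σ v) v := sameCycle_apply_left.2 (SameCycle.refl σ v)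
    rw [hc.cycleRep_eq, hv.2] at hσ
    exact hv.1 hσ.symm
  have := Finset.card_sdiff_add_card_eq_card σ.nonRep_subset_support
  omega

theorem card_nonRep_add_card_quotient_le (σ : Equiv.Perm V) :
    σ.nonRep.card + Nat.card (Quotient (SameCycle.setoid σ)) ≤ Nat.card V := by
  have h1 := Finset.card_filter_add_card_filter_not (s := (Finset.univ : Finset V))
    (fun v => σ.cycleRep v ≠ v)
  have h2 : Nat.card (Quotient (SameCycle.setoid σ)) ≤
      (Finset.univ.filter fun v => ¬ σ.cycleRep v ≠ v).card := by
    rw [← Nat.card_eq_finsetCard]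
    refine Nat.card_le_card_of_injective
      (fun q => ⟨q.out, ?_⟩) (fun p q hpq => Quotient.out_injective (congrArg Subtype.val hpq))
    simp [cycleRep]
  rw [Nat.card_eq_fintype_card (α := V), ← Finset.card_univ]
  unfold nonRep
  omega

variable {S : Finset (Equiv.Perm V)}

/-- The points moved by some element of `S`. -/
def movedPoints (S : Finset (Equiv.Perm V)) : Finset V :=
  S.biUnion support

/-- If `g` moves `x`, left multiplication by `g` sends the elements fixing `x` to elements moving
it, so at least half of `S` moves `x`. Double counting the pairs of a permutation and a point it
moves gives the factor 2. -/
theorem card_movedPoints_le (hne : S.Nonempty) (hmul : ∀ σ ∈ S, ∀ τ ∈ S, σ * τ ∈ S) {N : ℕ}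
    (hN : ∀ σ ∈ S, σ.support.card ≤ N) : (movedPoints S).card ≤ 2 * N := by
  have hhalf : ∀ x ∈ movedPoints S, S.card ≤ 2 * (S.filter fun σ => x ∈ σ.support).card := by
    intro x hx
    obtain ⟨g, hg, hgx⟩ := Finset.mem_biUnion.1 hx
    have h1 := Finset.card_filter_add_card_filter_not (s := S) (fun σ => x ∈ σ.support)
    have h2 : (S.filter fun σ => ¬ x ∈ σ.support).card ≤
        (S.filter fun σ => x ∈ σ.support).card := by
      refine Finset.card_le_card_of_injOn (fun σ => g * σ) ?_ (mul_right_injective g).injOn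
      intro σ hσ
      rw [Finset.mem_coe, Finset.mem_filter, notMem_support] at hσ
      rw [Finset.mem_coe, Finset.mem_filter, mem_support, mul_apply, hσ.2]
      exact ⟨hmul g hg σ hσ.1, mem_support.1 hgx⟩
    omega
  have h1 := Finset.card_nsmul_le_sum _ _ _ hhalf
  have h2 : ∑ x ∈ movedPoints S, (S.filter fun σ => x ∈ σ.support).card =
      ∑ σ ∈ S, ((movedPoints S).filter fun x => x ∈ σ.support).card :=
    Finset.sum_card_bipartiteAbove_eq_sum_card_bipartiteBelow fun x σ => x ∈ support σ
  have h3 : ∑ σ ∈ S, ((movedPoints S).filter fun x => x ∈ σ.support).card ≤ S.card • N :=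
    Finset.sum_le_card_nsmul _ _ _ fun σ hσ => (Finset.card_le_card
      (fun x hx => (Finset.mem_filter.1 hx).2)).trans (hN σ hσ)
  rw [← Finset.mul_sum, h2, smul_eq_mul] at h1
  rw [smul_eq_mul] at h3
  have : (movedPoints S).card * S.card ≤ 2 * N * S.card := by linarith
  exact Nat.le_of_mul_le_mul_right this hne.card_pos

/-- A set of permutations with all but at most `ℓ` points in a transversal, moving at most
`N` points in total, has at most `2 ^ N * N ^ ℓ` elements. -/
theorem card_le_of_card_nonRep_le {N ℓ : ℕ} (hN : (movedPoints S).card ≤ N)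
    (hℓ : ∀ σ ∈ S, σ.nonRep.card ≤ ℓ) (hNℓ : N = 0 → ℓ = 0) : S.card ≤ 2 ^ N * N ^ ℓ := by
  -- Codes: the set `T` of non-representatives, with the values on `T`; off `T` the function is set
  -- to the identity.
  let Ω : Finset (Σ _ : Finset V, V → V) :=
    ((movedPoints S).powerset.filter fun T => T.card ≤ ℓ).sigma fun T =>
      Fintype.piFinset fun v => if v ∈ T then movedPoints S else {v}
  have hsupp : ∀ σ ∈ S, σ.support ⊆ movedPoints S := fun σ hσ =>
    Finset.subset_biUnion_of_mem support hσ
  have hinj : S.card ≤ Ω.card := by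
    refine Finset.card_le_card_of_injOn
      (fun σ => ⟨σ.nonRep, fun v => if v ∈ σ.nonRep then σ v else v⟩) ?_ ?_
    · intro σ hσ
      simp only [Ω, Finset.mem_coe, Finset.mem_sigma, Finset.mem_filter, Finset.mem_powerset,
        Fintype.mem_piFinset]
      refine ⟨⟨σ.nonRep_subset_support.trans (hsupp σ hσ), hℓ σ hσ⟩, fun v => ?_⟩
      split_ifs with hv
      · exact hsupp σ hσ (apply_mem_support.2 (σ.nonRep_subset_support hv))
      · exact Finset.mem_singleton_self v
    · intro σ _ τ _ h
      simp only [Sigma.mk.injEq, heq_eq_eq] at h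
      obtain ⟨h1, h2⟩ := h
      refine eq_of_cycleRep (fun v => ?_) (fun v hv => ?_)
      · rw [← not_iff_not]
        change σ.cycleRep v ≠ v ↔ τ.cycleRep v ≠ v
        rw [← mem_nonRep, h1, mem_nonRep]
      · have h3 := congrFun h2 v
        have h4 := mem_nonRep.2 hv
        rwa [if_pos h4, if_pos (h1 ▸ h4)] at h3
  refine hinj.trans ?_
  rw [Finset.card_sigma]
  have hterm : ∀ T ∈ (movedPoints S).powerset.filter fun T => T.card ≤ ℓ,
      (Fintype.piFinset fun v => if v ∈ T then movedPoints S else {v}).card ≤ N ^ ℓ := by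
    intro T hT
    have hTℓ := (Finset.mem_filter.1 hT).2
    rw [Fintype.card_piFinset]
    have : ∀ v, (if v ∈ T then movedPoints S else {v}).card =
        if v ∈ T then (movedPoints S).card else 1 := fun v => by split_ifs <;> simp
    rw [Finset.prod_congr rfl fun v _ => this v, Finset.prod_ite_mem, Finset.univ_inter,
      Finset.prod_const]
    refine (Nat.pow_le_pow_left hN _).trans ?_
    -- Raising the exponent from `T.card` to `ℓ` needs a positive base.
    rcases Nat.eq_zero_or_pos N with h0 | hpos
    · rw [hNℓ h0] at hTℓ ⊢
      rw [Nat.le_zero.1 hTℓ]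
    · exact Nat.pow_le_pow_right hpos hTℓ
  refine (Finset.sum_le_card_nsmul _ _ _ hterm).trans ?_
  rw [smul_eq_mul]
  refine Nat.mul_le_mul_right _ ((Finset.card_filter_le _ _).trans ?_)
  rw [Finset.card_powerset]
  exact Nat.pow_le_pow_right (by norm_num) hN

end Counting

end Equiv.Perm

/-! ### The bound for the automorphism group -/

theorem SimpleGraph.card_aut_le {V : Type u} [Fintype V] (G : SimpleGraph V) {ℓ : ℕ}
    (h : ∀ σ : G ≃g G,
      Nat.card V ≤ Nat.card (Quotient (Equiv.Perm.SameCycle.setoid σ.toEquiv)) + ℓ) :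
    Nat.card (G ≃g G) ≤ (64 * ℓ) ^ ℓ := by
  classical
  let S : Finset (Equiv.Perm V) := Finset.univ.filter fun τ => ∃ σ : G ≃g G, σ.toEquiv = τ
  have hS : Nat.card (G ≃g G) ≤ S.card := by
    rw [← Nat.card_eq_finsetCard]
    exact Nat.card_le_card_of_injective (fun σ => ⟨σ.toEquiv, by simp [S]⟩)
      (fun σ τ hστ => RelIso.toEquiv_injective (congrArg Subtype.val hστ))
  have hℓ : ∀ σ ∈ S, σ.nonRep.card ≤ ℓ := by
    intro τ hτ
    obtain ⟨σ, rfl⟩ := (Finset.mem_filter.1 hτ).2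
    have h1 := h σ
    have h2 := Equiv.Perm.card_nonRep_add_card_quotient_le σ.toEquiv
    omega
  have hmul : ∀ σ ∈ S, ∀ τ ∈ S, σ * τ ∈ S := by
    intro σ hσ τ hτ
    obtain ⟨σ, rfl⟩ := (Finset.mem_filter.1 hσ).2
    obtain ⟨τ, rfl⟩ := (Finset.mem_filter.1 hτ).2
    exact Finset.mem_filter.2 ⟨Finset.mem_univ _, τ.trans σ, rfl⟩
  have hne : S.Nonempty := ⟨1, Finset.mem_filter.2 ⟨Finset.mem_univ _, RelIso.refl _, rfl⟩⟩
  have hm := Equiv.Perm.card_movedPoints_le hne hmul (N := 2 * ℓ) fun σ hσ =>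
    σ.card_support_le_two_mul_card_nonRep.trans (Nat.mul_le_mul_left 2 (hℓ σ hσ))
  -- With `N = 4 * ℓ` the count is `2 ^ (4 * ℓ) * (4 * ℓ) ^ ℓ`, and `64 = 2 ^ 4 * 4`.
  refine hS.trans ((Equiv.Perm.card_le_of_card_nonRep_le hm hℓ (by omega)).trans (le_of_eq ?_))
  rw [show 2 * (2 * ℓ) = 4 * ℓ by ring, pow_mul, ← mul_pow]
  ring

theorem SimpleGraph.ncard_neighborSet_eq_degree {V : Type u} [Fintype V] (G : SimpleGraph V)
    [DecidableRel G.Adj] (v : V) : (G.neighborSet v).ncard = G.degree v := by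
  rw [Set.ncard_eq_toFinset_card', ← G.card_neighborFinset_eq_degree]
  rfl

theorem mainTheorem1 :
    ∃ C : ℝ, 0 < C ∧
      ∀ (V : Type u) [Fintype V] (G : SimpleGraph V) [DecidableRel G.Adj] (d k ℓ : ℕ),
        G.maxDegree = d →
        max (4 * d) (d ^ 2) < k →
        k ≤ G.twinWidth →
        (∀ (W : Type u) [Fintype W] (H : SimpleGraph W) [DecidableRel H.Adj],
          H.maxDegree = d → Fintype.card W + ℓ < Fintype.card V → H.twinWidth < k) →
        (Nat.card (G ≃g G) : ℝ) ≤ (C * ℓ) ^ ℓ := by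
  refine ⟨64, by norm_num, ?_⟩
  intro V _ G _ d k ℓ hd hk hG hmin
  have h := G.card_aut_le (ℓ := ℓ) <| SimpleGraph.card_le_card_sameCycle_add (d := d) (k := k)
    (fun v => by rw [G.ncard_neighborSet_eq_degree, ← hd]; exact G.degree_le_maxDegree v) hk hG ?_
  · exact_mod_cast h
  · intro W _ H hH ⟨v, hv⟩ hcard
    classical
    refine hmin W H (le_antisymm ?_ ?_) hcard
    · exact SimpleGraph.maxDegree_le_of_forall_degree_le _ d fun w => by
        rw [← H.ncard_neighborSet_eq_degree]
        exact hH w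
    · rw [← hv, H.ncard_neighborSet_eq_degree]
      exact H.degree_le_maxDegree v
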